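/- Let $p,q\ge 0$ be integers with $n=p+q$ odd, let $\eta=\mathrm{diag}(1,\dots,1,-1,\dots,-1)$ ($p$ entries $+1$, $q$ entries $-1$), and let $\mathcal{C}\ell(p,q)$ be the real Clifford algebra with identity $e$ and generators $e^1,\dots,e^n$, $e^ae^b+e^be^a=2\eta^{ab}e$. For $x^1,\dots,x^n\in\mathcal{C}\ell(p,q)$ and an ordered multi-index $A=a_1\dots a_k$, $1\le a_1<\dots<a_k\le n$, $0\le k\le n$, put $|A|=k$ and $x^A=x^{a_1}\cdots x^{a_k}$ ($x^{\varnothing}=e$), and write $x_A=(x^A)^{-1}$ when $x^A$ is invertible. Say that $x^1,\dots,x^n$ generate a basis if the $2^n$ elements $x^A$ form a basis of $\mathcal{C}\ell(p,q)$. Suppose that $\gamma^a,\beta^a\in\mathcal{C}\ell(p,q)$, $a=1,\dots,n$, satisfy $$\gamma^a\gamma^b+\gamma^b\gamma^a=2\eta^{ab}e,\qquad \beta^a\beta^b+\beta^b\beta^a=2\eta^{ab}e\qquad(a,b=1,\dots,n)$$ (so all $\gamma^A,\beta^A$ are invertible). For an element $c\in\{e,-e,e^{1\dots n},-e^{1\dots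 n}\}$ consider, for invertible $T\in\mathcal{C}\ell(p,q)$, the relation $$(R_c)\qquad \gamma^a=c\,T^{-1}\beta^aT\qquad\text{for all }a=1,\dots,n.$$ (i) If $p-q\equiv1\pmod 4$, then for each of the two sets the top product ($\gamma^{1\dots n}$, respectively $\beta^{1\dots n}$) either equals $\pm e^{1\dots n}$ and the set generates a basis, or equals $\pm e$ and the set does not generate a basis. Exactly one of the four equalities $\beta^{1\dots n}=c\,\gamma^{1\dots n}$, $c\in\{e,-e,e^{1\dots n},-e^{1\dots n}\}$, holds. (ii) If $p-q\equiv3\pmod 4$, then $\gamma^{1\dots n}$ and $\beta^{1\dots n}$ both lie in $\{e^{1\dots n},-e^{1\dots n}\}$ and both sets generate bases. Exactly one of $\beta^{1\dots n}=\gamma^{1\dots n}$, $\beta^{1\dots n}=-\gamma^{1\dots n}$ holds; for $c=\pm e^{1\dots n}$ neither $\beta^{1\dots n}=c\,\gamma^{1\dots n}$ nor $(R_c)$ for any $T$ is possible. (iii) For each $c\in\{e,-e,e^{1\dots n},-e^{1\dots n}\}$: an invertible $T$ satisfying $(R_c)$ exists if and only if $\beta^{1\dots n}=c\,\gamma^{1\dots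 n}$, and then $T$ is unique up to multiplication by an invertible element of the center: the solutions of $(R_c)$ are exactly the elements $ZT$ with $Z$ central and invertible. (iv) An invertible $T$ satisfies one of the four relations $(R_c)$ if and only if $\gamma^a=(\beta^{1\dots n}\gamma_{1\dots n})\,T^{-1}\beta^aT$ for all $a$. (v) Let $H_{\mathrm{Even}}(U)=2^{1-n}\sum_{|A|\text{ even}}\beta^AU\gamma_A$. If $p-q\equiv1\pmod4$, there are multi-indices $A,B$ of even length (possibly equal) such that $T=H_{\mathrm{Even}}(\gamma^A+\gamma^B)$ is invertible and satisfies $(R_c)$ for the $c$ with $\beta^{1\dots n}=c\,\gamma^{1\dots n}$. If $p-q\equiv3\pmod4$, there is a multi-index $A$ of even length with $H_{\mathrm{Even}}(\gamma^A)\ne0$, and for every such $A$ the element $T=H_{\mathrm{Even}}(\gamma^A)$ is invertible and satisfies $(R_c)$ for the $c\in\{e,-e\}$ with $\beta^{1\dots n}=c\,\gamma^{1\dots n}$. -/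

import Mathlib

noncomputable section

namespace PauliOdd

/-- The diagonal entries of `η`: the first `p` are `+1`, the last `q` are `-1`. -/
def sgn (p q : ℕ) (a : Fin (p + q)) : ℝ := if (a : ℕ) < p then 1 else -1

/-- The matrix `η = diag(1, …, 1, -1, …, -1)`. -/
def eta (p q : ℕ) : Matrix (Fin (p + q)) (Fin (p + q)) ℝ := Matrix.diagonal (sgn p q)

/-- The real Clifford algebra of signature `(p, q)`: the Clifford algebra of the quadratic form
`x ↦ ∑ a, η^{aa} x_a ^ 2` on `ℝ^(p+q)`. -/
abbrev Cl (p q : ℕ) : Type :=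
  CliffordAlgebra (QuadraticMap.weightedSumSquares ℝ (sgn p q))

variable {p q : ℕ}

/-- The standard generators `e^a`. -/
def gen (p q : ℕ) (a : Fin (p + q)) : Cl p q :=
  CliffordAlgebra.ι (QuadraticMap.weightedSumSquares ℝ (sgn p q)) (Pi.single a 1)

/-- `γ^a γ^b + γ^b γ^a = 2 η^{ab} e` for all `a`, `b`. -/
def CliffordRelations (γ : Fin (p + q) → Cl p q) : Prop :=
  ∀ a b, γ a * γ b + γ b * γ a = (2 * eta p q a b) • (1 : Cl p q)

/-- `γ^A = γ^{a_1} ⋯ γ^{a_k}` for the ordered multi-index `A = a_1 < ⋯ < a_k`, encoded as the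
finite set of its entries. -/
def up (γ : Fin (p + q) → Cl p q) (A : Finset (Fin (p + q))) : Cl p q :=
  ((A.sort (· ≤ ·)).map γ).prod

/-- `γ_A = (γ^A)⁻¹`. (Under `CliffordRelations γ` every `γ^A` is invertible.) -/
def down (γ : Fin (p + q) → Cl p q) (A : Finset (Fin (p + q))) : Cl p q :=
  Ring.inverse (up γ A)

/-- `γ^{1…n}`. -/
def top (γ : Fin (p + q) → Cl p q) : Cl p q := up γ Finset.univ

/-- `e^{1…n}`. -/
def vol (p q : ℕ) : Cl p q := top (gen p q)

/-- The family `γ^A`, over all multi-indices `A`, is a basis of the Clifford algebra. -/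
def GeneratesBasis (γ : Fin (p + q) → Cl p q) : Prop :=
  LinearIndependent ℝ (up γ) ∧ Submodule.span ℝ (Set.range (up γ)) = ⊤

/-- `γ^a = c T⁻¹ β^a T` for all `a`. -/
def Connects (c : Cl p q) (β γ : Fin (p + q) → Cl p q) (T : (Cl p q)ˣ) : Prop :=
  ∀ a, γ a = c * ((↑T⁻¹ : Cl p q) * β a * (T : Cl p q))

/-- `H_Even(U) = 2^{-(n-1)} ∑_{|A| even} β^A U γ_A`. -/
def HEven (β γ : Fin (p + q) → Cl p q) (U : Cl p q) : Cl p q :=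
  ((1 : ℝ) / 2 ^ (p + q - 1)) •
    ∑ A : Finset (Fin (p + q)) with Even A.card, up β A * U * down γ A

end PauliOdd

end

/-!
Generators `γ` of signature `η` satisfy `γ^A γ^B = ± γ^{A ∆ B}` with a sign that depends only on
`η`. Hence, for two systems `β`, `γ` of the same signature, `U ↦ ∑ β^A U γ_A` over the even
multi-indices averages over a group action, and its values intertwine the even parts of the algebras
generated by `γ` and `β`. As `n` is odd, the average of `γ^C` (with `β = γ`) vanishes for every even
`C ≠ ∅`. So the Clifford algebra is a direct sum of `2^(n-1)` copies of the space of intertwiners,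
which therefore has dimension two; for `β = γ` it is the center, spanned by `e` and `e^{1…n}`.

The top product is central and `γ^a` is, up to sign, the top product times the even monomial of the
complement of `a`. So `γ^a = c T⁻¹ β^a T` for all `a` means that `T` is an intertwiner and
`β^{1…n} = c γ^{1…n}`, and everything reduces to finding invertible intertwiners. For an
intertwiner `T ≠ 0` some even average `X` in the opposite direction makes `T X` central and nonzero.
If `e^{1…n}` squares to `-e`, the center is a copy of `ℂ` and every nonzero intertwiner is
invertible. If it squares to `e`, the center is `ℝ ⊕ ℝ`, and an intertwiner is invertible as soon as
neither of the idempotents `(e ± e^{1…n}) / 2` kills it; a sum of two averages achieves this.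
-/

noncomputable section

namespace PauliOdd

open scoped symmDiff Ring

section OrderedProducts

variable {ι M : Type*} [LinearOrder ι] [Monoid M]

/-- The product of the `γ a`, `a ∈ A`, taken in increasing order of the indices: the monomial
`γ^A` of an ordered multi-index, in an arbitrary monoid. -/
def orderedProd (γ : ι → M) (A : Finset ι) : M := ((A.sort (· ≤ ·)).map γ).prod

lemma orderedProd_empty (γ : ι → M) : orderedProd γ ∅ = 1 := by
  simp [orderedProd]

lemma orderedProd_singleton (γ : ι → M) (a : ι) : orderedProd γ {a} = γ a := by
  simp [orderedProd]

lemma orderedProd_insert (γ : ι → M) {a : ι} {A : Finset ι} (h : ∀ b ∈ A, a < b) :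
    orderedProd γ (insert a A) = γ a * orderedProd γ A := by
  have ha : a ∉ A := fun haA ↦ lt_irrefl _ (h a haA)
  rw [orderedProd, Finset.sort_insert _ (fun b hb ↦ (h b hb).le) ha, List.map_cons,
    List.prod_cons, orderedProd]

lemma map_orderedProd {N F : Type*} [Monoid N] [FunLike F M N] [MonoidHomClass F M N] (f : F)
    (γ : ι → M) (A : Finset ι) : f (orderedProd γ A) = orderedProd (f ∘ γ) A := by
  rw [orderedProd, map_list_prod, List.map_map, orderedProd]

lemma orderedProd_central_mul_conj {c : M} (hc : c ∈ Set.center M) (γ : ι → M) (T : Mˣ)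
    (A : Finset ι) :
    orderedProd (fun a ↦ c * (↑T⁻¹ * γ a * T)) A =
      c ^ A.card * (↑T⁻¹ * orderedProd γ A * T) := by
  induction A using Finset.induction_on_min with
  | empty => simp [orderedProd_empty]
  | insert a A ha ih =>
    have haA : a ∉ A := fun h ↦ lt_irrefl _ (ha a h)
    have hcomm : ∀ x, Commute (c ^ A.card) x := fun x ↦
      Commute.pow_left (Semigroup.mem_center_iff.1 hc x).symm _
    rw [orderedProd_insert _ ha, ih, orderedProd_insert _ ha, Finset.card_insert_of_notMem haA,
      pow_succ', mul_assoc c, ← mul_assoc _ (c ^ _), ← (hcomm _).eq]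
    simp only [mul_assoc, Units.mul_inv_cancel_left]

end OrderedProducts

section IndexSets

variable {ι : Type*}

section

variable [DecidableEq ι]

lemma card_symmDiff_add_two_mul_card_inter (A B : Finset ι) :
    (A ∆ B).card + 2 * (A ∩ B).card = A.card + B.card := by
  have hA := Finset.card_sdiff_add_card_inter A B
  have hB := Finset.card_sdiff_add_card_inter B A
  have hAB : (A ∆ B).card = (A \ B).card + (B \ A).card :=
    Finset.card_union_of_disjoint disjoint_sdiff_sdiff
  rw [Finset.inter_comm B A] at hB
  omega

lemma even_card_symmDiff_iff {A B : Finset ι} :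
    Even (A ∆ B).card ↔ (Even A.card ↔ Even B.card) := by
  rw [← Nat.even_add, ← card_symmDiff_add_two_mul_card_inter, Nat.even_add]
  simp

lemma singleton_symmDiff_of_notMem {a : ι} {A : Finset ι} (ha : a ∉ A) :
    {a} ∆ A = insert a A := by
  rw [(Finset.disjoint_singleton_left.2 ha).symmDiff_eq_sup, Finset.sup_eq_union,
    Finset.insert_eq]

lemma prod_symmDiff (f : ι → ℤˣ) (A B : Finset ι) :
    ∏ a ∈ A ∆ B, f a = (∏ a ∈ A, f a) * ∏ b ∈ B, f b := by
  have hsq := Int.units_mul_self (∏ a ∈ A ∩ B, f a)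
  rw [← Finset.prod_inter_mul_prod_sdiff A B, ← Finset.prod_inter_mul_prod_sdiff B A,
    Finset.inter_comm B A, mul_mul_mul_comm, hsq, one_mul]
  exact Finset.prod_union disjoint_sdiff_sdiff

end

variable [Fintype ι]

variable (ι) in
/-- The even multi-indices, over which `H_Even` sums. -/
def evenSets : Finset (Finset ι) := {A | Even A.card}

lemma mem_evenSets {A : Finset ι} : A ∈ evenSets ι ↔ Even A.card := by
  simp [evenSets]

lemma empty_mem_evenSets : ∅ ∈ evenSets ι := by
  simp [evenSets]

lemma symmDiff_mem_evenSets_iff [DecidableEq ι] {A B : Finset ι} (hB : B ∈ evenSets ι) :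
    A ∆ B ∈ evenSets ι ↔ A ∈ evenSets ι := by
  simp only [mem_evenSets] at hB ⊢
  simp [even_card_symmDiff_iff, hB]

lemma sum_evenSets_symmDiff [DecidableEq ι] {M : Type*} [AddCommMonoid M] {B : Finset ι}
    (hB : B ∈ evenSets ι) (f : Finset ι → M) :
    ∑ A ∈ evenSets ι, f (A ∆ B) = ∑ A ∈ evenSets ι, f A :=
  Finset.sum_equiv (symmDiff_left_involutive B).toPerm
    (fun _ ↦ (symmDiff_mem_evenSets_iff hB).symm) fun _ _ ↦ rfl

lemma two_mul_card_evenSets [Nonempty ι] :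
    2 * (evenSets ι).card = 2 ^ Fintype.card ι := by
  classical
  obtain ⟨a⟩ := ‹Nonempty ι›
  have hodd : (evenSets ι)ᶜ.card = (evenSets ι).card :=
    Finset.card_equiv (symmDiff_left_involutive {a}).toPerm fun A ↦ by
      simp [mem_evenSets, even_card_symmDiff_iff]
  rw [two_mul, ← Fintype.card_finset, ← Finset.card_add_card_compl (evenSets ι), hodd]

lemma isUnit_card_evenSets {R : Type*} [Ring R] [Nonempty ι] (h : IsUnit (2 : R)) :
    IsUnit ((evenSets ι).card : R) := by
  have hcard : (2 * (evenSets ι).card : R) = 2 ^ Fintype.card ι := by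
    exact_mod_cast congrArg (Nat.cast : ℕ → R) (two_mul_card_evenSets (ι := ι))
  exact ((Nat.cast_commute 2 _).isUnit_mul_iff.1 (hcard ▸ h.pow _)).2

/-- Pairing `C` with `C ∆ {a, b}` for `a ∈ A`, `b ∉ A` flips the sign of each term. -/
lemma sum_evenSets_neg_one_pow_card_inter [DecidableEq ι] {A : Finset ι} (hA : A.Nonempty)
    (hA' : A ≠ Finset.univ) : ∑ C ∈ evenSets ι, (-1 : ℤ) ^ (C ∩ A).card = 0 := by
  obtain ⟨a, ha⟩ := hA
  obtain ⟨b, hb⟩ : ∃ b, b ∉ A := by simpa [Finset.eq_univ_iff_forall] using hA'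
  have hab : a ≠ b := fun h ↦ hb (h ▸ ha)
  have hD : {a, b} ∈ evenSets ι := by simp [mem_evenSets, Finset.card_pair hab]
  have hDA : {a, b} ∩ A = {a} := by
    rw [Finset.insert_inter_of_mem ha, Finset.singleton_inter_of_notMem hb]
    rfl
  have hflip (C : Finset ι) : (-1 : ℤ) ^ ((C ∆ {a, b}) ∩ A).card = -(-1) ^ (C ∩ A).card := by
    have hcard := card_symmDiff_add_two_mul_card_inter (C ∩ A) {a}
    have : (-1 : ℤ) ^ ((C ∩ A) ∆ {a}).card = (-1) ^ ((C ∩ A).card + 1) := by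
      rw [← Finset.card_singleton a, ← hcard, pow_add, pow_mul]; simp
    have hinter : (C ∆ {a, b}) ∩ A = (C ∩ A) ∆ {a} := by
      rw [← hDA]; exact inf_symmDiff_distrib_right _ _ _
    rw [hinter, this, pow_succ, mul_neg_one]
  have hneg := sum_evenSets_symmDiff hD fun C ↦ (-1 : ℤ) ^ (C ∩ A).card
  simp only [hflip, Finset.sum_neg_distrib] at hneg
  omega

end IndexSets

section CliffordSystems

variable {ι R : Type*} [LinearOrder ι] [Ring R]

/-- The defining relations of Clifford generators with squares `η a = ±1`, in an arbitrary ring. -/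
structure IsCliffordSystem (η : ι → ℤˣ) (γ : ι → R) : Prop where
  mul_self : ∀ a, γ a * γ a = η a • (1 : R)
  anticomm : ∀ a b, a ≠ b → γ a * γ b = -(γ b * γ a)

/-- The sign with which `γ^a γ^b` becomes the monomial of the multi-index `{a} ∆ {b}`. -/
def pairSign (η : ι → ℤˣ) (a b : ι) : ℤˣ :=
  if a < b then 1 else if a = b then η a else -1

/-- The sign in `γ^A γ^B = ± γ^{A ∆ B}`; it depends on the signature, but not on `γ`. -/
def prodSign (η : ι → ℤˣ) (A B : Finset ι) : ℤˣ := ∏ a ∈ A, ∏ b ∈ B, pairSign η a b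

variable {η : ι → ℤˣ}

lemma pairSign_self (a : ι) : pairSign η a a = η a := by
  simp [pairSign]

lemma pairSign_comm (a b : ι) :
    pairSign η a b = (if a = b then 1 else -1) * pairSign η b a := by
  rcases lt_trichotomy a b with h | rfl | h
  · simp [pairSign, h, h.ne, h.ne', h.not_gt]
  · simp
  · simp [pairSign, h, h.ne', h.not_gt]

lemma prodSign_comm (A B : Finset ι) :
    prodSign η A B = (-1) ^ (A.card * B.card + (A ∩ B).card) * prodSign η B A := by
  have hsign : ∏ a ∈ A, ∏ b ∈ B, (if a = b then 1 else -1 : ℤˣ) =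
      (-1) ^ (A.card * B.card + (A ∩ B).card) := by
    have h (a b : ι) : (if a = b then 1 else -1 : ℤˣ) = -1 * if b = a then -1 else 1 := by
      rcases eq_or_ne a b with rfl | h <;> simp [*, Ne.symm]
    simp_rw [h, Finset.prod_mul_distrib, Finset.prod_const, Finset.prod_ite_eq',
      Finset.prod_ite_mem, Finset.prod_const, ← pow_mul, ← pow_add, mul_comm B.card]
  rw [prodSign, prodSign, Finset.prod_comm (s := B), ← hsign, ← Finset.prod_mul_distrib]
  refine Finset.prod_congr rfl fun a _ ↦ ?_
  rw [← Finset.prod_mul_distrib]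
  exact Finset.prod_congr rfl fun b _ ↦ pairSign_comm a b

lemma prodSign_symmDiff_left (A B C : Finset ι) :
    prodSign η (A ∆ B) C = prodSign η A C * prodSign η B C := by
  simp only [prodSign, prod_symmDiff]

lemma prodSign_symmDiff_right (A B C : Finset ι) :
    prodSign η A (B ∆ C) = prodSign η A B * prodSign η A C := by
  simp only [prodSign, prod_symmDiff, Finset.prod_mul_distrib]

lemma prodSign_singleton_of_lt {a : ι} {B : Finset ι} (h : ∀ b ∈ B, a < b) :
    prodSign η {a} B = 1 := by
  rw [prodSign, Finset.prod_singleton]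
  exact Finset.prod_eq_one fun b hb ↦ if_pos (h b hb)

lemma prodSign_self (A : Finset ι) :
    prodSign η A A = (-1) ^ A.card.choose 2 * ∏ a ∈ A, η a := by
  induction A using Finset.induction_on with
  | empty => simp [prodSign]
  | insert a A ha ih =>
    have hself : prodSign η {a} {a} = η a := by simp [prodSign, pairSign_self]
    have hcomm : prodSign η A {a} = (-1) ^ A.card * prodSign η {a} A := by
      rw [prodSign_comm, Finset.inter_singleton_of_notMem ha]; simp
    calc prodSign η (insert a A) (insert a A)
        = prodSign η {a} {a} * prodSign η {a} A * (prodSign η A {a} * prodSign η A A) := by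
          rw [← singleton_symmDiff_of_notMem ha, prodSign_symmDiff_left, prodSign_symmDiff_right,
            prodSign_symmDiff_right]
      _ = prodSign η {a} A * prodSign η {a} A *
            ((-1) ^ (A.card + A.card.choose 2) * (η a * ∏ b ∈ A, η b)) := by
          rw [hself, hcomm, ih, pow_add]; ac_rfl
      _ = (-1) ^ (insert a A).card.choose 2 * ∏ b ∈ insert a A, η b := by
          rw [Int.units_mul_self, one_mul, Finset.card_insert_of_notMem ha,
            Finset.prod_insert ha, Nat.choose_succ_succ' _ 1, Nat.choose_one_right]

namespace IsCliffordSystem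

variable {γ : ι → R}

lemma mul_orderedProd (hγ : IsCliffordSystem η γ) (a : ι) (B : Finset ι) :
    γ a * orderedProd γ B = prodSign η {a} B • orderedProd γ ({a} ∆ B) := by
  induction B using Finset.induction_on_min with
  | empty =>
    rw [← Finset.bot_eq_empty, symmDiff_bot, Finset.bot_eq_empty, orderedProd_empty,
      orderedProd_singleton, mul_one]
    simp [prodSign]
  | insert b B hb ih =>
    have hbB : b ∉ B := fun h ↦ lt_irrefl _ (hb b h)
    have hpair : prodSign η {a} {b} = pairSign η a b := by simp [prodSign]
    rw [← singleton_symmDiff_of_notMem hbB, prodSign_symmDiff_right, hpair,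
      singleton_symmDiff_of_notMem hbB]
    rcases lt_trichotomy a b with hab | rfl | hba
    · have hmin : ∀ c ∈ insert b B, a < c := by
        simpa [hab] using fun c hc ↦ hab.trans (hb c hc)
      have hsign : prodSign η {a} B = 1 :=
        prodSign_singleton_of_lt fun c hc ↦ hab.trans (hb c hc)
      rw [singleton_symmDiff_of_notMem fun h ↦ lt_irrefl _ (hmin a h),
        orderedProd_insert γ hmin, hsign, pairSign, if_pos hab, one_mul, one_smul]
    · rw [← singleton_symmDiff_of_notMem hbB, symmDiff_symmDiff_cancel_left,
        singleton_symmDiff_of_notMem hbB, orderedProd_insert γ hb, ← mul_assoc, hγ.mul_self,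
        smul_mul_assoc, one_mul, pairSign_self, prodSign_singleton_of_lt hb, mul_one]
    · have hmin : ∀ c ∈ {a} ∆ B, b < c := by
        intro c hc
        rcases Finset.mem_symmDiff.1 hc with ⟨hca, -⟩ | ⟨hcB, -⟩
        · rwa [Finset.mem_singleton.1 hca]
        · exact hb c hcB
      have hset : {a} ∆ insert b B = insert b ({a} ∆ B) := by
        rw [← singleton_symmDiff_of_notMem hbB, symmDiff_left_comm,
          singleton_symmDiff_of_notMem fun h ↦ lt_irrefl _ (hmin b h)]
      rw [hset, orderedProd_insert γ hb, orderedProd_insert γ hmin, ← mul_assoc,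
        hγ.anticomm a b hba.ne', neg_mul, mul_assoc, ih, pairSign, if_neg hba.not_gt,
        if_neg hba.ne', mul_smul_comm, neg_one_mul, Units.neg_smul]

lemma orderedProd_mul_orderedProd (hγ : IsCliffordSystem η γ) (A B : Finset ι) :
    orderedProd γ A * orderedProd γ B = prodSign η A B • orderedProd γ (A ∆ B) := by
  induction A using Finset.induction_on_min with
  | empty =>
    rw [← Finset.bot_eq_empty, bot_symmDiff, Finset.bot_eq_empty, orderedProd_empty, one_mul]
    simp [prodSign]
  | insert a A ha ih =>
    have haA : a ∉ A := fun h ↦ lt_irrefl _ (ha a h)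
    have hsign : prodSign η {a} (A ∆ B) = prodSign η {a} B := by
      rw [prodSign_symmDiff_right, prodSign_singleton_of_lt ha, one_mul]
    rw [orderedProd_insert γ ha, mul_assoc, ih, mul_smul_comm, hγ.mul_orderedProd, hsign,
      smul_smul, ← singleton_symmDiff_of_notMem haA, symmDiff_assoc, prodSign_symmDiff_left,
      mul_comm]

lemma orderedProd_mul_self (hγ : IsCliffordSystem η γ) (A : Finset ι) :
    orderedProd γ A * orderedProd γ A = prodSign η A A • 1 := by
  rw [hγ.orderedProd_mul_orderedProd, symmDiff_self, Finset.bot_eq_empty, orderedProd_empty]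

lemma isUnit_orderedProd (hγ : IsCliffordSystem η γ) (A : Finset ι) :
    IsUnit (orderedProd γ A) := by
  have h : prodSign η A A • (orderedProd γ A * orderedProd γ A) = 1 := by
    rw [hγ.orderedProd_mul_self, smul_smul, Int.units_mul_self, one_smul]
  exact ⟨⟨_, prodSign η A A • orderedProd γ A, by rwa [mul_smul_comm], by rwa [smul_mul_assoc]⟩,
    rfl⟩

lemma inverse_orderedProd (hγ : IsCliffordSystem η γ) (A : Finset ι) :
    (orderedProd γ A)⁻¹ʳ = prodSign η A A • orderedProd γ A := by
  refine left_inv_eq_right_inv (Ring.inverse_mul_cancel _ (hγ.isUnit_orderedProd A)) ?_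
  rw [mul_smul_comm, hγ.orderedProd_mul_self, smul_smul, Int.units_mul_self, one_smul]

lemma inverse_orderedProd_mul_inverse_orderedProd (hγ : IsCliffordSystem η γ) (A B : Finset ι) :
    (orderedProd γ B)⁻¹ʳ * (orderedProd γ A)⁻¹ʳ =
      prodSign η A B • (orderedProd γ (A ∆ B))⁻¹ʳ := by
  refine left_inv_eq_right_inv (a := orderedProd γ A * orderedProd γ B) ?_ ?_
  · rw [mul_assoc, Ring.inverse_mul_cancel_left _ _ (hγ.isUnit_orderedProd A),
      Ring.inverse_mul_cancel _ (hγ.isUnit_orderedProd B)]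
  · rw [hγ.orderedProd_mul_orderedProd, smul_mul_smul_comm, Int.units_mul_self, one_smul,
      Ring.mul_inverse_cancel _ (hγ.isUnit_orderedProd _)]

lemma orderedProd_mul_comm (hγ : IsCliffordSystem η γ) (A B : Finset ι) :
    orderedProd γ A * orderedProd γ B =
      (-1 : ℤˣ) ^ (A.card * B.card + (A ∩ B).card) • (orderedProd γ B * orderedProd γ A) := by
  rw [hγ.orderedProd_mul_orderedProd, hγ.orderedProd_mul_orderedProd, smul_smul,
    ← prodSign_comm, symmDiff_comm]

/-- The signs of the two products cancel, so this is an action of the group of multi-indices. -/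
lemma orderedProd_mul_mul_inverse_orderedProd {β : ι → R} (hβ : IsCliffordSystem η β)
    (hγ : IsCliffordSystem η γ) (A B : Finset ι) (U : R) :
    orderedProd β A * (orderedProd β B * U * (orderedProd γ B)⁻¹ʳ) * (orderedProd γ A)⁻¹ʳ =
      orderedProd β (A ∆ B) * U * (orderedProd γ (A ∆ B))⁻¹ʳ := by
  calc _ = orderedProd β A * orderedProd β B * U *
          ((orderedProd γ B)⁻¹ʳ * (orderedProd γ A)⁻¹ʳ) := by simp only [mul_assoc]
    _ = _ := by
      rw [hβ.orderedProd_mul_orderedProd, hγ.inverse_orderedProd_mul_inverse_orderedProd,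
        smul_mul_assoc, smul_mul_smul_comm, Int.units_mul_self, one_smul]

section Top

variable [Fintype ι]

lemma commute_orderedProd_univ_orderedProd (hγ : IsCliffordSystem η γ)
    (hn : Odd (Fintype.card ι)) (A : Finset ι) :
    Commute (orderedProd γ Finset.univ) (orderedProd γ A) := by
  have h := hγ.orderedProd_mul_comm Finset.univ A
  have heven : Even (Fintype.card ι * A.card + A.card) := by
    rw [← Nat.succ_mul]; exact (hn.add_one).mul_right _
  rwa [Finset.univ_inter, Finset.card_univ, heven.neg_one_pow, one_smul] at h

lemma eq_smul_orderedProd_univ_mul (hγ : IsCliffordSystem η γ) (a : ι) :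
    γ a = prodSign η Finset.univ {a}ᶜ •
      (orderedProd γ Finset.univ * orderedProd γ {a}ᶜ) := by
  have hset : Finset.univ ∆ {a}ᶜ = {a} := by
    ext x; simp [Finset.mem_symmDiff]
  rw [hγ.orderedProd_mul_orderedProd, smul_smul, Int.units_mul_self, one_smul, hset,
    orderedProd_singleton]

end Top

end IsCliffordSystem

/-- `T` intertwines the even parts of the algebras generated by `γ` and `β`. -/
def Intertwines (β γ : ι → R) (T : R) : Prop :=
  ∀ A : Finset ι, Even A.card → orderedProd β A * T = T * orderedProd γ A

variable {α β γ : ι → R} {T U : R}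

lemma Intertwines.trans (hT : Intertwines α β T) (hU : Intertwines β γ U) :
    Intertwines α γ (T * U) := fun A hA ↦ by
  rw [← mul_assoc, hT A hA, mul_assoc, hU A hA, mul_assoc]

lemma Intertwines.symm {T : Rˣ} (hT : Intertwines β γ (T : R)) :
    Intertwines γ β (↑T⁻¹ : R) := fun A hA ↦ by
  rw [← T.mul_right_inj, T.mul_inv_cancel_left, ← mul_assoc, ← hT A hA, T.mul_inv_cancel_right]

/-- The space of all `T` intertwining the even parts of the algebras generated by `γ` and `β`. -/
def intertwiners (K : Type*) [CommRing K] [Algebra K R] (β γ : ι → R) : Submodule K R where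
  carrier := {T | Intertwines β γ T}
  add_mem' hT hU A hA := by rw [mul_add, add_mul, hT A hA, hU A hA]
  zero_mem' A _ := by rw [mul_zero, zero_mul]
  smul_mem' r T hT A hA := by rw [mul_smul_comm, smul_mul_assoc, hT A hA]

lemma mem_intertwiners {K : Type*} [CommRing K] [Algebra K R] :
    T ∈ intertwiners K β γ ↔ Intertwines β γ T := Iff.rfl

variable [Fintype ι]

/-- The sum `∑ β^A U γ_A` over even multi-indices, i.e. `H_Even` without its scalar factor. -/
def evenSum (β γ : ι → R) : R →+ R :=
  AddMonoidHom.mk' (fun U ↦ ∑ A ∈ evenSets ι, orderedProd β A * U * (orderedProd γ A)⁻¹ʳ)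
    fun U V ↦ by simp only [mul_add, add_mul, Finset.sum_add_distrib]

lemma evenSum_apply (β γ : ι → R) (U : R) :
    evenSum β γ U = ∑ A ∈ evenSets ι, orderedProd β A * U * (orderedProd γ A)⁻¹ʳ := rfl

lemma evenSum_smul {S : Type*} [DistribSMul S R] [IsScalarTower S R R] [SMulCommClass S R R]
    (s : S) (U : R) : evenSum β γ (s • U) = s • evenSum β γ U := by
  simp only [evenSum_apply, mul_smul_comm, smul_mul_assoc, Finset.smul_sum]

lemma Intertwines.evenSum_mul (hT : Intertwines α β T) (U : R) :
    evenSum α γ (T * U) = T * evenSum β γ U := by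
  rw [evenSum_apply, evenSum_apply, Finset.mul_sum]
  refine Finset.sum_congr rfl fun A hA ↦ ?_
  rw [← mul_assoc (orderedProd α A), hT A (mem_evenSets.1 hA)]
  simp only [mul_assoc]

lemma intertwines_evenSum (hβ : IsCliffordSystem η β) (hγ : IsCliffordSystem η γ) (U : R) :
    Intertwines β γ (evenSum β γ U) := fun B hB ↦ by
  have hconj : orderedProd β B * evenSum β γ U * (orderedProd γ B)⁻¹ʳ = evenSum β γ U := by
    rw [evenSum_apply, Finset.mul_sum, Finset.sum_mul,
      ← sum_evenSets_symmDiff (mem_evenSets.2 hB) fun A ↦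
        orderedProd β A * U * (orderedProd γ A)⁻¹ʳ]
    refine Finset.sum_congr rfl fun A _ ↦ ?_
    rw [hβ.orderedProd_mul_mul_inverse_orderedProd hγ, symmDiff_comm]
  conv_rhs => rw [← hconj]
  rw [Ring.inverse_mul_cancel_right _ _ (hγ.isUnit_orderedProd B)]

namespace IsCliffordSystem

lemma evenSum_self_orderedProd (hγ : IsCliffordSystem η γ) (hn : Odd (Fintype.card ι))
    {A : Finset ι} (hA : Even A.card) :
    evenSum γ γ (orderedProd γ A) = if A = ∅ then ((evenSets ι).card : R) else 0 := by
  have hconj (C : Finset ι) : orderedProd γ C * orderedProd γ A * (orderedProd γ C)⁻¹ʳ =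
      (-1 : ℤ) ^ (C ∩ A).card • orderedProd γ A := by
    rw [hγ.orderedProd_mul_comm, pow_add, (hA.mul_left _).neg_one_pow, one_mul, smul_mul_assoc,
      Ring.mul_inverse_cancel_right _ _ (hγ.isUnit_orderedProd C), Units.smul_def]
    simp
  rw [evenSum_apply, Finset.sum_congr rfl fun C _ ↦ hconj C, ← Finset.sum_smul]
  rcases A.eq_empty_or_nonempty with rfl | hne
  · simp [orderedProd_empty]
  · have huniv : A ≠ Finset.univ := fun h ↦
      (Nat.not_even_iff_odd.2 hn) (by rwa [h, Finset.card_univ] at hA)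
    rw [sum_evenSets_neg_one_pow_card_inter hne huniv, zero_smul, if_neg hne.ne_empty]

lemma sum_evenSum_mul (hγ : IsCliffordSystem η γ) (hn : Odd (Fintype.card ι)) (β : ι → R)
    (U : R) :
    ∑ C ∈ evenSets ι, evenSum β γ (U * orderedProd γ C) * (orderedProd γ C)⁻¹ʳ =
      U * (evenSets ι).card := by
  have hself {A : Finset ι} (hA : A ∈ evenSets ι) : evenSum γ γ (orderedProd γ A)⁻¹ʳ =
      if A = ∅ then ((evenSets ι).card : R) else 0 := by
    rw [hγ.inverse_orderedProd, evenSum_smul,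
      hγ.evenSum_self_orderedProd hn (mem_evenSets.1 hA)]
    split_ifs with h
    · simp [h, prodSign]
    · rw [smul_zero]
  calc _ = ∑ A ∈ evenSets ι, orderedProd β A * U * evenSum γ γ (orderedProd γ A)⁻¹ʳ := by
        simp only [evenSum_apply, Finset.sum_mul, Finset.mul_sum]
        rw [Finset.sum_comm]
        simp only [mul_assoc]
    _ = _ := by
        rw [Finset.sum_congr rfl fun A hA ↦ by rw [hself hA, mul_ite, mul_zero],
          Finset.sum_ite_eq', if_pos empty_mem_evenSets, orderedProd_empty, one_mul]

lemma evenSum_mul_inverse_mul (hγ : IsCliffordSystem η γ) (hn : Odd (Fintype.card ι))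
    (hT : Intertwines β γ T) {C D : Finset ι} (hC : Even C.card) (hD : Even D.card) :
    evenSum β γ (T * (orderedProd γ C)⁻¹ʳ * orderedProd γ D) =
      if C = D then T * (evenSets ι).card else 0 := by
  rw [mul_assoc, hT.evenSum_mul, hγ.inverse_orderedProd, smul_mul_assoc,
    hγ.orderedProd_mul_orderedProd, smul_smul, evenSum_smul,
    hγ.evenSum_self_orderedProd hn (even_card_symmDiff_iff.2 (iff_of_true hC hD))]
  rcases eq_or_ne C D with rfl | h
  · simp [Int.units_mul_self]
  · rw [if_neg h, if_neg (by rwa [← Finset.bot_eq_empty, symmDiff_eq_bot]), smul_zero, mul_zero]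

end IsCliffordSystem

section Decomposition

lemma Intertwines.exists_mul_evenSum_ne_zero (hγ : IsCliffordSystem η γ)
    (hn : Odd (Fintype.card ι)) (h2 : IsUnit (2 : R)) (hT : Intertwines α β T) (hT0 : T ≠ 0) :
    ∃ C, Even C.card ∧ T * evenSum β γ (orderedProd γ C) ≠ 0 := by
  have : Nonempty ι := Fintype.card_pos_iff.1 hn.pos
  by_contra! h
  refine hT0 ((isUnit_card_evenSets (ι := ι) h2).mul_left_eq_zero.1 ?_)
  rw [← hγ.sum_evenSum_mul hn α]
  refine Finset.sum_eq_zero fun C hC ↦ ?_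
  rw [hT.evenSum_mul, h C (mem_evenSets.1 hC), zero_mul]

variable (K : Type*) [CommRing K] [Algebra K R]

/-- The linear map assembling an element of the algebra from coefficients that intertwine `γ` and
`β`, one for each even monomial `γ_C`. -/
def assemble (β γ : ι → R) : (evenSets ι → intertwiners K β γ) →ₗ[K] R where
  toFun f := ∑ C, f C * (orderedProd γ C.1)⁻¹ʳ
  map_add' f g := by simp [add_mul, Finset.sum_add_distrib]
  map_smul' r f := by simp [Finset.smul_sum]

lemma assemble_apply (f : evenSets ι → intertwiners K β γ) :
    assemble K β γ f = ∑ C, f C * (orderedProd γ C.1)⁻¹ʳ := rfl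

lemma evenSum_assemble_mul (hγ : IsCliffordSystem η γ) (hn : Odd (Fintype.card ι))
    (f : evenSets ι → intertwiners K β γ) (D : evenSets ι) :
    evenSum β γ (assemble K β γ f * orderedProd γ D.1) = f D * (evenSets ι).card := by
  have hterm (C : evenSets ι) :
      evenSum β γ (f C * (orderedProd γ C.1)⁻¹ʳ * orderedProd γ D.1) =
        if C = D then (f C : R) * (evenSets ι).card else 0 := by
    simpa only [Subtype.ext_iff] using hγ.evenSum_mul_inverse_mul hn (mem_intertwiners.1 (f C).2)
      (mem_evenSets.1 C.2) (mem_evenSets.1 D.2)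
  simp only [assemble_apply, Finset.sum_mul, map_sum, hterm, Finset.sum_ite_eq',
    Finset.mem_univ, if_true]

lemma bijective_assemble (hβ : IsCliffordSystem η β) (hγ : IsCliffordSystem η γ)
    (hn : Odd (Fintype.card ι)) (h2 : IsUnit (2 : R)) :
    Function.Bijective (assemble K β γ) := by
  have : Nonempty ι := Fintype.card_pos_iff.1 hn.pos
  obtain ⟨m, hm⟩ := isUnit_card_evenSets (ι := ι) h2
  constructor
  · refine (injective_iff_map_eq_zero _).2 fun f hf ↦ funext fun D ↦ Subtype.ext ?_
    have h := evenSum_assemble_mul K hγ hn f D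
    rw [hf, zero_mul, map_zero, ← hm, eq_comm, Units.mul_left_eq_zero] at h
    exact h
  · refine fun U ↦ ⟨fun C ↦ ⟨evenSum β γ (U * ↑m⁻¹ * orderedProd γ C.1),
      intertwines_evenSum hβ hγ _⟩, ?_⟩
    rw [assemble_apply, Finset.sum_coe_sort (evenSets ι) fun C ↦
      evenSum β γ (U * ↑m⁻¹ * orderedProd γ C) * (orderedProd γ C)⁻¹ʳ,
      hγ.sum_evenSum_mul hn, ← hm, Units.inv_mul_cancel_right]

lemma span_range_orderedProd_eq_top (hγ : IsCliffordSystem η γ)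
    (hn : Odd (Fintype.card ι)) (h2 : IsUnit (2 : R))
    (h : intertwiners K γ γ ≤ Submodule.span K {1, orderedProd γ Finset.univ}) :
    Submodule.span K (Set.range (orderedProd γ)) = ⊤ := by
  set S := Submodule.span K (Set.range (orderedProd γ))
  have hmem (C : Finset ι) (u : ℤˣ) : u • orderedProd γ C ∈ S := by
    rw [Units.smul_def]; exact zsmul_mem (Submodule.subset_span (Set.mem_range_self C)) _
  have hmul (C : Finset ι) : intertwiners K γ γ ≤
      S.comap (LinearMap.mulRight K (orderedProd γ C)⁻¹ʳ) := by
    refine h.trans (Submodule.span_le.2 ?_)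
    simp only [Set.insert_subset_iff, Set.singleton_subset_iff, SetLike.mem_coe,
      Submodule.mem_comap, LinearMap.mulRight_apply, one_mul, hγ.inverse_orderedProd,
      mul_smul_comm, hγ.orderedProd_mul_orderedProd, smul_smul, hmem, and_self]
  refine eq_top_iff.2 fun U _ ↦ ?_
  obtain ⟨f, rfl⟩ := (bijective_assemble K hγ hγ hn h2).2 U
  exact Submodule.sum_mem _ fun C _ ↦ hmul C.1 (f C).2

lemma finrank_eq_card_evenSets_mul (F : Type*) [Field F] [Algebra F R] [FiniteDimensional F R]
    (hβ : IsCliffordSystem η β) (hγ : IsCliffordSystem η γ) (hn : Odd (Fintype.card ι))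
    (h2 : IsUnit (2 : R)) :
    Module.finrank F R = (evenSets ι).card * Module.finrank F (intertwiners F β γ) := by
  rw [← (LinearEquiv.ofBijective _ (bijective_assemble F hβ hγ hn h2)).finrank_eq,
    Module.finrank_pi_fintype, Finset.sum_const, Finset.card_univ, Fintype.card_coe, smul_eq_mul]

end Decomposition

end CliffordSystems

section RealCliffordAlgebra

variable {p q : ℕ} {β γ : Fin (p + q) → Cl p q}

/-- The diagonal of `η` as a vector of signs. -/
def signature (p q : ℕ) (a : Fin (p + q)) : ℤˣ := if (a : ℕ) < p then 1 else -1

lemma sgn_smul (a : Fin (p + q)) (x : Cl p q) : sgn p q a • x = signature p q a • x := by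
  by_cases ha : (a : ℕ) < p <;> simp [sgn, signature, ha]

lemma CliffordRelations.isCliffordSystem (hγ : CliffordRelations γ) :
    IsCliffordSystem (signature p q) γ where
  mul_self a := by
    have h := hγ a a
    rw [eta, Matrix.diagonal_apply_eq, ← two_smul ℝ (γ a * γ a), mul_smul, sgn_smul] at h
    exact smul_right_injective _ (two_ne_zero' ℝ) h
  anticomm a b hab := by
    have h := hγ a b
    rw [eta, Matrix.diagonal_apply_ne _ hab, mul_zero, zero_smul] at h
    exact eq_neg_of_add_eq_zero_left h

lemma isCliffordSystem_gen : IsCliffordSystem (signature p q) (gen p q) where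
  mul_self a := by
    rw [gen, CliffordAlgebra.ι_sq_scalar, Algebra.algebraMap_eq_smul_one, ← sgn_smul]
    simp [QuadraticMap.weightedSumSquares_apply, Pi.single_apply]
  anticomm a b hab := by
    refine CliffordAlgebra.ι_mul_ι_comm_of_isOrtho (QuadraticMap.isOrtho_def.2 ?_)
    simp only [QuadraticMap.weightedSumSquares_apply, ← Finset.sum_add_distrib]
    refine Finset.sum_congr rfl fun i _ ↦ ?_
    rcases eq_or_ne i a with rfl | hia
    · simp [hab]
    · simp [hia]

lemma isUnit_two : IsUnit (2 : Cl p q) := by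
  have h := (isUnit_iff_ne_zero.2 (two_ne_zero' ℝ)).map (algebraMap ℝ (Cl p q))
  rwa [map_ofNat] at h

lemma odd_card_fin (hn : Odd (p + q)) : Odd (Fintype.card (Fin (p + q))) := by
  rwa [Fintype.card_fin]

section Center

/-- A basis of the Clifford algebra as a vector space, transported from the exterior algebra; it is
not the family of the monomials `e^A`. -/
def basis (p q : ℕ) : Module.Basis (Finset (Fin (p + q))) ℝ (Cl p q) :=
  have : Invertible (2 : ℝ) := invertibleOfNonzero two_ne_zero
  ((Pi.basisFun ℝ (Fin (p + q))).ExteriorAlgebra).map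
    (CliffordAlgebra.equivExterior (QuadraticMap.weightedSumSquares ℝ (sgn p q))).symm

instance : FiniteDimensional ℝ (Cl p q) := .of_basis (basis p q)

lemma finrank_cl : Module.finrank ℝ (Cl p q) = 2 ^ (p + q) := by
  rw [Module.finrank_eq_card_basis (basis p q), Fintype.card_finset, Fintype.card_fin]

lemma mem_center_of_forall_commute_gen {x : Cl p q} (h : ∀ a, Commute (gen p q a) x) :
    x ∈ Subalgebra.center ℝ (Cl p q) := by
  refine Subalgebra.mem_center_iff.2 fun y ↦ ?_
  refine (Algebra.commute_of_mem_adjoin_of_forall_mem_commute (R := ℝ)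
    (s := Set.range (CliffordAlgebra.ι (QuadraticMap.weightedSumSquares ℝ (sgn p q)))) (a := x)
    (b := y) (by simp [CliffordAlgebra.adjoin_range_ι]) ?_).eq.symm
  rintro _ ⟨v, rfl⟩
  rw [pi_eq_sum_univ' v, map_sum]
  refine Commute.sum_right _ _ _ fun a _ ↦ ?_
  rw [map_smul]
  exact (h a).symm.smul_right (v a)

lemma vol_mem_center (hn : Odd (p + q)) : vol p q ∈ Subalgebra.center ℝ (Cl p q) :=
  mem_center_of_forall_commute_gen fun a ↦ by
    have h := isCliffordSystem_gen.commute_orderedProd_univ_orderedProd (odd_card_fin hn) {a}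
    rw [orderedProd_singleton] at h
    exact h.symm

lemma involute_vol (hn : Odd (p + q)) : CliffordAlgebra.involute (vol p q) = -vol p q := by
  have h := orderedProd_central_mul_conj (Set.neg_mem_center Set.one_mem_center) (gen p q) 1
    Finset.univ
  have hgen : CliffordAlgebra.involute ∘ gen p q =
      fun a ↦ -1 * (↑(1 : (Cl p q)ˣ)⁻¹ * gen p q a * (1 : (Cl p q)ˣ)) := by
    ext a; simp [gen]
  rw [Finset.card_univ, (odd_card_fin hn).neg_one_pow, ← hgen] at h
  rw [vol, top, up, ← orderedProd, map_orderedProd, h]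
  simp

lemma linearIndependent_one_vol (hn : Odd (p + q)) :
    LinearIndependent ℝ ![(1 : Cl p q), vol p q] := by
  refine LinearIndependent.pair_iff.2 fun r t h ↦ ?_
  have hvol : IsUnit (vol p q) := isCliffordSystem_gen.isUnit_orderedProd Finset.univ
  have h' := congrArg CliffordAlgebra.involute h
  rw [map_add, map_smul, map_smul, map_one, involute_vol hn, map_zero, smul_neg] at h'
  have hr : (2 * r) • (1 : Cl p q) = 0 := by linear_combination (norm := module) h + h'
  have ht : (2 * t) • vol p q = 0 := by linear_combination (norm := module) h - h'
  simpa [hvol.ne_zero] using And.intro hr ht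

lemma finrank_intertwiners (hn : Odd (p + q)) (hβ : IsCliffordSystem (signature p q) β)
    (hγ : IsCliffordSystem (signature p q) γ) :
    Module.finrank ℝ (intertwiners ℝ β γ) = 2 := by
  have : Nonempty (Fin (p + q)) := ⟨0, hn.pos⟩
  have h := finrank_eq_card_evenSets_mul ℝ hβ hγ (odd_card_fin hn) isUnit_two
  have hcard := two_mul_card_evenSets (ι := Fin (p + q))
  rw [Fintype.card_fin] at hcard
  rw [finrank_cl, ← hcard, mul_comm] at h
  exact (mul_left_cancel₀ (Finset.card_ne_zero_of_mem empty_mem_evenSets) h).symm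

lemma span_one_vol_le_center (hn : Odd (p + q)) :
    Submodule.span ℝ {1, vol p q} ≤ Subalgebra.toSubmodule (Subalgebra.center ℝ (Cl p q)) :=
  Submodule.span_le.2 (Set.pair_subset (Subalgebra.one_mem _) (vol_mem_center hn))

lemma intertwines_self_of_mem_center {z : Cl p q} (hz : z ∈ Subalgebra.center ℝ (Cl p q)) :
    Intertwines γ γ z := fun _ _ ↦ Subalgebra.mem_center_iff.1 hz _

lemma span_one_vol_eq (hn : Odd (p + q)) (hγ : IsCliffordSystem (signature p q) γ) :
    Submodule.span ℝ {1, vol p q} = intertwiners ℝ γ γ := by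
  refine Submodule.eq_of_le_of_finrank_eq
    (fun _ hz ↦ intertwines_self_of_mem_center (span_one_vol_le_center hn hz)) ?_
  rw [finrank_intertwiners hn hγ hγ, ← Matrix.range_cons_cons_empty,
    finrank_span_eq_card (linearIndependent_one_vol hn), Fintype.card_fin]

lemma intertwines_self_iff (hn : Odd (p + q)) (hγ : IsCliffordSystem (signature p q) γ)
    {z : Cl p q} : Intertwines γ γ z ↔ z ∈ Subalgebra.center ℝ (Cl p q) := by
  refine ⟨fun h ↦ ?_, intertwines_self_of_mem_center⟩
  have hspan : z ∈ Submodule.span ℝ {1, vol p q} := span_one_vol_eq hn hγ ▸ h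
  exact span_one_vol_le_center hn hspan

lemma mem_center_iff (hn : Odd (p + q)) {z : Cl p q} :
    z ∈ Subalgebra.center ℝ (Cl p q) ↔ ∃ r t : ℝ, r • 1 + t • vol p q = z := by
  rw [← intertwines_self_iff hn isCliffordSystem_gen, ← mem_intertwiners (K := ℝ),
    ← span_one_vol_eq hn isCliffordSystem_gen, Submodule.mem_span_pair]

end Center

section TopProduct

lemma prod_signature : ∏ a, signature p q a = (-1) ^ q := by
  rw [Fin.prod_univ_add]
  simp [signature]

lemma neg_one_pow_choose_two {n : ℕ} (hn : Odd n) : (-1 : ℤˣ) ^ n.choose 2 = (-1) ^ (n / 2) := by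
  obtain ⟨k, rfl⟩ := hn
  have hchoose : (2 * k + 1).choose 2 = (2 * k + 1) * k := by
    rw [Nat.choose_two_right, Nat.add_sub_cancel, mul_left_comm, Nat.mul_div_cancel_left _ two_pos]
  have hhalf : (2 * k + 1) / 2 = k := by omega
  rw [hchoose, hhalf, pow_mul, (odd_two_mul_add_one k).neg_one_pow]

namespace IsCliffordSystem

lemma isUnit_top (hγ : IsCliffordSystem (signature p q) γ) : IsUnit (top γ) :=
  hγ.isUnit_orderedProd _

lemma top_mul_top (hn : Odd (p + q)) (hγ : IsCliffordSystem (signature p q) γ) :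
    top γ * top γ = (-1 : ℤˣ) ^ ((p + q) / 2 + q) • 1 := by
  have h := hγ.orderedProd_mul_self Finset.univ
  rwa [prodSign_self, prod_signature, Finset.card_univ, Fintype.card_fin,
    neg_one_pow_choose_two hn, ← pow_add] at h

lemma top_mem_center (hn : Odd (p + q)) (hγ : IsCliffordSystem (signature p q) γ) :
    top γ ∈ Subalgebra.center ℝ (Cl p q) :=
  (intertwines_self_iff hn hγ).1 fun A _ ↦
    (hγ.commute_orderedProd_univ_orderedProd (odd_card_fin hn) A).symm

end IsCliffordSystem

lemma vol_mul_vol_of_modEq_one (h : (p : ℤ) - q ≡ 1 [ZMOD 4]) : vol p q * vol p q = 1 := by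
  have h' : ((p : ℤ) - q) % 4 = 1 := h
  have heven : Even ((p + q) / 2 + q) := Nat.even_iff.2 (by omega)
  rw [vol, isCliffordSystem_gen.top_mul_top (Nat.odd_iff.2 (by omega)), heven.neg_one_pow,
    one_smul]

lemma vol_mul_vol_of_modEq_three (h : (p : ℤ) - q ≡ 3 [ZMOD 4]) : vol p q * vol p q = -1 := by
  have h' : ((p : ℤ) - q) % 4 = 3 := h
  have hodd : Odd ((p + q) / 2 + q) := Nat.odd_iff.2 (by omega)
  rw [vol, isCliffordSystem_gen.top_mul_top (Nat.odd_iff.2 (by omega)), hodd.neg_one_pow,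
    Units.neg_smul, one_smul]

lemma exists_vol_mul_vol_eq_smul_one (hn : Odd (p + q)) :
    ∃ s : ℝ, vol p q * vol p q = s • 1 ∧ (s = 1 ∨ s = -1) := by
  have h := isCliffordSystem_gen.top_mul_top hn
  rw [← vol] at h
  rcases Int.units_eq_one_or ((-1) ^ ((p + q) / 2 + q)) with hs | hs <;> rw [hs] at h
  · exact ⟨1, by simpa using h, .inl rfl⟩
  · exact ⟨-1, by simpa [Units.neg_smul] using h, .inr rfl⟩

lemma neg_one_ne_one : (-1 : Cl p q) ≠ 1 := fun h ↦
  isUnit_two.ne_zero (by rw [← one_add_one_eq_two, ← sub_eq_zero.2 h.symm, sub_neg_eq_add])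

/-- The four factors `c` allowed in the relations `γ^a = c T⁻¹ β^a T`. -/
def factors (p q : ℕ) : Set (Cl p q) := {1, -1, vol p q, -vol p q}

lemma mul_mem_factors (hvol : vol p q * vol p q = 1 ∨ vol p q * vol p q = -1) {a b : Cl p q}
    (ha : a ∈ factors p q) (hb : b ∈ factors p q) : a * b ∈ factors p q := by
  simp only [factors, Set.mem_insert_iff, Set.mem_singleton_iff] at ha hb ⊢
  rcases hvol with hvol | hvol <;> rcases ha with rfl | rfl | rfl | rfl <;>
    rcases hb with rfl | rfl | rfl | rfl <;> simp [hvol]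

lemma factors_subset_center (hn : Odd (p + q)) {c : Cl p q} (hc : c ∈ factors p q) :
    c ∈ Subalgebra.center ℝ (Cl p q) := by
  have hvol := vol_mem_center hn
  have hone := (Subalgebra.center ℝ (Cl p q)).one_mem
  rcases hc with rfl | rfl | rfl | rfl
  exacts [hone, neg_mem hone, hvol, neg_mem hvol]

lemma IsCliffordSystem.top_eq (hn : Odd (p + q)) (hγ : IsCliffordSystem (signature p q) γ) :
    (top γ = vol p q ∨ top γ = -vol p q) ∨
      vol p q * vol p q = 1 ∧ (top γ = 1 ∨ top γ = -1) := by
  obtain ⟨r, t, htop⟩ := (mem_center_iff hn).1 (hγ.top_mem_center hn)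
  obtain ⟨s, hvol, hs⟩ := exists_vol_mul_vol_eq_smul_one hn
  have hsq : top γ * top γ = s • 1 := by
    rw [← hvol, hγ.top_mul_top hn, vol, isCliffordSystem_gen.top_mul_top hn]
  have hcoeff : (r * r + t * t * s - s) • (1 : Cl p q) + (2 * (r * t)) • vol p q = 0 := by
    rw [← htop] at hsq
    simp only [mul_add, add_mul, smul_mul_smul_comm, one_mul, mul_one, hvol] at hsq
    linear_combination (norm := module) hsq
  obtain ⟨hs', hrt⟩ := LinearIndependent.pair_iff.1 (linearIndependent_one_vol hn) _ _ hcoeff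
  rcases mul_eq_zero.1 ((mul_eq_zero.1 hrt).resolve_left two_ne_zero) with rfl | rfl
  · have ht : t = 1 ∨ t = -1 := by
      rw [← mul_self_eq_one_iff]
      rcases hs with rfl | rfl <;> linarith
    rcases ht with rfl | rfl <;> simp [← htop]
  · have hr : s = 1 ∧ (r = 1 ∨ r = -1) := by
      rw [← mul_self_eq_one_iff]
      rcases hs with rfl | rfl
      · exact ⟨rfl, by linarith⟩
      · nlinarith
    obtain ⟨rfl, rfl | rfl⟩ := hr <;> simp [← htop, hvol]

lemma IsCliffordSystem.top_mem_factors (hn : Odd (p + q))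
    (hγ : IsCliffordSystem (signature p q) γ) : top γ ∈ factors p q := by
  rcases hγ.top_eq hn with (h | h) | ⟨-, h | h⟩ <;> simp [factors, h]

lemma exists_factor (hn : Odd (p + q)) (hβ : IsCliffordSystem (signature p q) β)
    (hγ : IsCliffordSystem (signature p q) γ) : ∃ c ∈ factors p q, top β = c * top γ := by
  obtain ⟨s, hvol, hs⟩ := exists_vol_mul_vol_eq_smul_one hn
  have hsq : top γ * top γ = s • 1 := by
    rw [← hvol, hγ.top_mul_top hn, vol, isCliffordSystem_gen.top_mul_top hn]
  have hvol' : vol p q * vol p q = 1 ∨ vol p q * vol p q = -1 := by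
    rcases hs with rfl | rfl <;> simp [hvol]
  have hmem := mul_mem_factors hvol' (hβ.top_mem_factors hn) (hγ.top_mem_factors hn)
  rcases hs with rfl | rfl
  · exact ⟨_, hmem, by rw [mul_assoc, hsq, one_smul, mul_one]⟩
  · exact ⟨-1 * (top β * top γ), mul_mem_factors hvol' (by simp [factors]) hmem,
      by rw [mul_assoc, mul_assoc, hsq]; simp⟩

lemma top_mul_down_eq (hγ : IsCliffordSystem (signature p q) γ) {c : Cl p q}
    (hc : top β = c * top γ) : top β * down γ Finset.univ = c := by
  rw [hc, down, ← top, Ring.mul_inverse_cancel_right _ _ hγ.isUnit_top]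

end TopProduct

section Connections

variable {c : Cl p q} {T T' : (Cl p q)ˣ}

lemma mul_self_eq_one_of_top_eq (hn : Odd (p + q)) (hβ : IsCliffordSystem (signature p q) β)
    (hγ : IsCliffordSystem (signature p q) γ) (hc : c ∈ Subalgebra.center ℝ (Cl p q))
    (h : top β = c * top γ) : c * c = 1 := by
  have hcomm : Commute c (top γ) := (Subalgebra.mem_center_iff.1 hc _).symm
  have hsq : c * c * (top γ * top γ) = 1 * (top γ * top γ) := by
    rw [hcomm.mul_mul_mul_comm, ← h, one_mul, hβ.top_mul_top hn, hγ.top_mul_top hn]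
  exact (hγ.isUnit_top.mul hγ.isUnit_top).mul_right_cancel hsq

lemma Connects.mul_self_eq_one (hn : Odd (p + q)) (hβ : IsCliffordSystem (signature p q) β)
    (hγ : IsCliffordSystem (signature p q) γ) (hc : c ∈ Subalgebra.center ℝ (Cl p q))
    (h : Connects c β γ T) : c * c = 1 := by
  let a : Fin (p + q) := ⟨0, hn.pos⟩
  have hcomm : Commute (↑T⁻¹ * β a * T) c := Subalgebra.mem_center_iff.1 hc _
  have hconj : (↑T⁻¹ * β a * T) * (↑T⁻¹ * β a * T) = signature p q a • 1 := by
    rw [← mul_assoc, ← mul_assoc, T.mul_inv_cancel_right, mul_assoc (↑T⁻¹ : Cl p q), hβ.mul_self,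
      mul_smul_comm, mul_one, smul_mul_assoc, T.inv_mul]
  have hsq := hγ.mul_self a
  rw [h a, hcomm.mul_mul_mul_comm, hconj, mul_smul_comm, mul_one] at hsq
  exact smul_left_cancel _ hsq

lemma Connects.orderedProd_eq (hc : c ∈ Subalgebra.center ℝ (Cl p q)) (h : Connects c β γ T)
    (A : Finset (Fin (p + q))) :
    orderedProd γ A = c ^ A.card * (↑T⁻¹ * orderedProd β A * T) := by
  rw [funext h]
  exact orderedProd_central_mul_conj hc β T A

lemma Connects.intertwines (hn : Odd (p + q)) (hβ : IsCliffordSystem (signature p q) β)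
    (hγ : IsCliffordSystem (signature p q) γ) (hc : c ∈ Subalgebra.center ℝ (Cl p q))
    (h : Connects c β γ T) : Intertwines β γ (T : Cl p q) := by
  rintro A ⟨k, hk⟩
  have hpow : c ^ A.card = 1 := by
    rw [hk, pow_add, ← (Commute.refl c).mul_pow, h.mul_self_eq_one hn hβ hγ hc, one_pow]
  rw [h.orderedProd_eq hc, hpow, one_mul, mul_assoc, T.mul_inv_cancel_left]

lemma Connects.top_eq (hn : Odd (p + q)) (hβ : IsCliffordSystem (signature p q) β)
    (hγ : IsCliffordSystem (signature p q) γ) (hc : c ∈ Subalgebra.center ℝ (Cl p q))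
    (h : Connects c β γ T) : top β = c * top γ := by
  have hcc := h.mul_self_eq_one hn hβ hγ hc
  obtain ⟨k, hk⟩ := odd_card_fin hn
  have hpow : c * c ^ (2 * k + 1) = 1 := by
    rw [← pow_succ', ← mul_add_one 2 k, pow_mul, sq, hcc, one_pow]
  have hconj : ↑T⁻¹ * top β * T = top β := by
    rw [mul_assoc, ← Subalgebra.mem_center_iff.1 (hβ.top_mem_center hn), T.inv_mul_cancel_left]
  have htop : top γ = c ^ (2 * k + 1) * (↑T⁻¹ * top β * T) := by
    rw [← hk, ← Finset.card_univ]; exact h.orderedProd_eq hc _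
  rw [htop, hconj, ← mul_assoc, hpow, one_mul]

lemma Intertwines.connects (hn : Odd (p + q)) (hβ : IsCliffordSystem (signature p q) β)
    (hγ : IsCliffordSystem (signature p q) γ) (hc : c ∈ Subalgebra.center ℝ (Cl p q))
    (htop : top β = c * top γ) (hT : Intertwines β γ (T : Cl p q)) : Connects c β γ T := fun a ↦ by
  have heven : Even ({a}ᶜ : Finset (Fin (p + q))).card := by
    rw [Finset.card_compl, Fintype.card_fin, Finset.card_singleton]
    exact Nat.Odd.sub_odd hn odd_one
  have hcomm : top β * T = T * top β := (Subalgebra.mem_center_iff.1 (hβ.top_mem_center hn) _).symm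
  have hconj : ↑T⁻¹ * (top β * orderedProd β {a}ᶜ) * T = top β * orderedProd γ {a}ᶜ := by
    rw [mul_assoc, mul_assoc, hT _ heven, ← mul_assoc (top β), hcomm, mul_assoc,
      T.inv_mul_cancel_left]
  have htop' : c * top β = top γ := by
    rw [htop, ← mul_assoc, mul_self_eq_one_of_top_eq hn hβ hγ hc htop, one_mul]
  rw [hγ.eq_smul_orderedProd_univ_mul a, hβ.eq_smul_orderedProd_univ_mul a, mul_smul_comm,
    smul_mul_assoc, mul_smul_comm]
  refine congrArg _ (Eq.symm ?_)
  calc c * (↑T⁻¹ * (top β * orderedProd β {a}ᶜ) * T) = c * (top β * orderedProd γ {a}ᶜ) := by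
        rw [hconj]
    _ = top γ * orderedProd γ {a}ᶜ := by rw [← mul_assoc, htop']

lemma connects_iff (hn : Odd (p + q)) (hβ : IsCliffordSystem (signature p q) β)
    (hγ : IsCliffordSystem (signature p q) γ) (hc : c ∈ Subalgebra.center ℝ (Cl p q)) :
    Connects c β γ T ↔ top β = c * top γ ∧ Intertwines β γ (T : Cl p q) :=
  ⟨fun h ↦ ⟨h.top_eq hn hβ hγ hc, h.intertwines hn hβ hγ hc⟩,
    fun h ↦ h.2.connects hn hβ hγ hc h.1⟩

lemma Intertwines.iff_exists_central_mul (hn : Odd (p + q))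
    (hβ : IsCliffordSystem (signature p q) β)
    (hT : Intertwines β γ (T : Cl p q)) : Intertwines β γ (T' : Cl p q) ↔
      ∃ Z : (Cl p q)ˣ, (Z : Cl p q) ∈ Subalgebra.center ℝ (Cl p q) ∧ T' = Z * T := by
  constructor
  · intro hT'
    refine ⟨T' * T⁻¹, ?_, (inv_mul_cancel_right T' T).symm⟩
    rw [Units.val_mul, ← intertwines_self_iff hn hβ]
    exact hT'.trans hT.symm
  · rintro ⟨Z, hZ, rfl⟩
    rw [Units.val_mul]
    exact (intertwines_self_of_mem_center hZ).trans hT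

lemma Connects.iff_exists_central_mul (hn : Odd (p + q))
    (hβ : IsCliffordSystem (signature p q) β) (hγ : IsCliffordSystem (signature p q) γ)
    (hc : c ∈ Subalgebra.center ℝ (Cl p q)) (hT : Connects c β γ T) : Connects c β γ T' ↔
      ∃ Z : (Cl p q)ˣ, (Z : Cl p q) ∈ Subalgebra.center ℝ (Cl p q) ∧ T' = Z * T := by
  rw [connects_iff hn hβ hγ hc, ← (hT.intertwines hn hβ hγ hc).iff_exists_central_mul hn hβ,
    and_iff_right (hT.top_eq hn hβ hγ hc)]

lemma existsUnique_factor (hn : Odd (p + q)) (hβ : IsCliffordSystem (signature p q) β)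
    (hγ : IsCliffordSystem (signature p q) γ) : ∃! c, c ∈ factors p q ∧ top β = c * top γ := by
  obtain ⟨c, hc, htop⟩ := exists_factor hn hβ hγ
  exact ⟨c, ⟨hc, htop⟩, fun d hd ↦ hγ.isUnit_top.mul_right_cancel (hd.2.symm.trans htop)⟩

lemma ne_vol_mul_of_vol_mul_vol_eq_neg_one (hn : Odd (p + q)) (hvol : vol p q * vol p q = -1)
    (hβ : IsCliffordSystem (signature p q) β) (hγ : IsCliffordSystem (signature p q) γ)
    (hc : c ∈ ({vol p q, -vol p q} : Set (Cl p q))) : top β ≠ c * top γ := fun h ↦ by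
  have hcc : c * c = -1 := by rcases hc with rfl | rfl <;> simp [hvol]
  have hmem : c ∈ Subalgebra.center ℝ (Cl p q) := factors_subset_center hn (.inr (.inr hc))
  exact neg_one_ne_one (hcc.symm.trans (mul_self_eq_one_of_top_eq hn hβ hγ hmem h))

lemma existsUnique_sign_factor (hn : Odd (p + q)) (hvol : vol p q * vol p q = -1)
    (hβ : IsCliffordSystem (signature p q) β) (hγ : IsCliffordSystem (signature p q) γ) :
    ∃! c, c ∈ ({1, -1} : Set (Cl p q)) ∧ top β = c * top γ := by
  refine (existsUnique_congr fun c ↦ ?_).1 (existsUnique_factor hn hβ hγ)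
  have hne := ne_vol_mul_of_vol_mul_vol_eq_neg_one hn hvol hβ hγ (c := c)
  simp only [factors, Set.mem_insert_iff, Set.mem_singleton_iff] at hne ⊢
  tauto

lemma connects_top_mul_down_iff (hn : Odd (p + q)) (hβ : IsCliffordSystem (signature p q) β)
    (hγ : IsCliffordSystem (signature p q) γ) :
    Connects (top β * down γ Finset.univ) β γ T ↔ ∃ c ∈ factors p q, Connects c β γ T := by
  constructor
  · obtain ⟨c, hc, htop⟩ := exists_factor hn hβ hγ
    rw [top_mul_down_eq hγ htop]
    exact fun h ↦ ⟨c, hc, h⟩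
  · rintro ⟨c, hc, h⟩
    rwa [top_mul_down_eq hγ (h.top_eq hn hβ hγ (factors_subset_center hn hc))]

end Connections

section UnitIntertwiners

instance : IsNoetherianRing (Cl p q) := .of_finite ℝ _

lemma Intertwines.exists_mul_ne_zero (hn : Odd (p + q)) (hβ : IsCliffordSystem (signature p q) β)
    (hγ : IsCliffordSystem (signature p q) γ) {T : Cl p q} (hT : Intertwines β γ T) (hT0 : T ≠ 0) :
    ∃ X, T * X ∈ Subalgebra.center ℝ (Cl p q) ∧ T * X ≠ 0 := by
  obtain ⟨C, -, hC⟩ := hT.exists_mul_evenSum_ne_zero hβ (odd_card_fin hn) isUnit_two hT0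
  exact ⟨_, (intertwines_self_iff hn hβ).1 (hT.trans (intertwines_evenSum hγ hβ _)), hC⟩

lemma exists_mul_evenSum_ne_zero (hn : Odd (p + q)) (hγ : IsCliffordSystem (signature p q) γ)
    (β : Fin (p + q) → Cl p q) {z : Cl p q} (hz : z ∈ Subalgebra.center ℝ (Cl p q)) (hz0 : z ≠ 0) :
    ∃ A : Finset (Fin (p + q)), Even A.card ∧ z * evenSum β γ (up γ A) ≠ 0 :=
  (intertwines_self_of_mem_center (γ := β) hz).exists_mul_evenSum_ne_zero hγ (odd_card_fin hn)
    isUnit_two hz0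

lemma isUnit_of_mem_center (hn : Odd (p + q)) (hvol : vol p q * vol p q = -1) {z : Cl p q}
    (hz : z ∈ Subalgebra.center ℝ (Cl p q)) (hz0 : z ≠ 0) : IsUnit z := by
  obtain ⟨r, t, rfl⟩ := (mem_center_iff hn).1 hz
  have hnorm : (r • 1 + t • vol p q) * (r • 1 - t • vol p q) = (r ^ 2 + t ^ 2) • 1 := by
    simp only [mul_sub, add_mul, smul_mul_smul_comm, one_mul, mul_one, hvol]
    module
  have hne : r ^ 2 + t ^ 2 ≠ 0 := fun h ↦ hz0 (by
    obtain ⟨rfl, rfl⟩ : r = 0 ∧ t = 0 := by constructor <;> nlinarith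
    simp)
  refine IsUnit.of_mul_eq_one ((r ^ 2 + t ^ 2)⁻¹ • (r • 1 - t • vol p q)) ?_
  rw [mul_smul_comm, hnorm, inv_smul_smul₀ hne]

lemma Intertwines.isUnit (hn : Odd (p + q)) (hvol : vol p q * vol p q = -1)
    (hβ : IsCliffordSystem (signature p q) β) (hγ : IsCliffordSystem (signature p q) γ)
    {T : Cl p q} (hT : Intertwines β γ T) (hT0 : T ≠ 0) : IsUnit T := by
  obtain ⟨X, hX, hX0⟩ := hT.exists_mul_ne_zero hn hβ hγ hT0
  exact isUnit_of_mul_isUnit_left (isUnit_of_mem_center hn hvol hX hX0)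

/-- The complementary central idempotents `(e ± e^{1…n}) / 2` when `e^{1…n}` squares to `e`. -/
def centralIdempotent (p q : ℕ) (ε : ℤˣ) : Cl p q := (1 / 2 : ℝ) • (1 + ε • vol p q)

lemma centralIdempotent_add : centralIdempotent p q 1 + centralIdempotent p q (-1) = 1 := by
  simp only [centralIdempotent, one_smul, Units.neg_smul]
  module

lemma centralIdempotent_mem_center (hn : Odd (p + q)) (ε : ℤˣ) :
    centralIdempotent p q ε ∈ Subalgebra.center ℝ (Cl p q) := by
  refine Subalgebra.smul_mem _ (add_mem (Subalgebra.one_mem _) ?_) _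
  rw [Units.smul_def]
  exact zsmul_mem (vol_mem_center hn) _

lemma centralIdempotent_ne_zero (hn : Odd (p + q)) (ε : ℤˣ) : centralIdempotent p q ε ≠ 0 := by
  intro h
  have := LinearIndependent.pair_iff.1 (linearIndependent_one_vol hn) (1 / 2) ((1 / 2) * (ε : ℤ))
    (by rw [← h, centralIdempotent, Units.smul_def]; module)
  norm_num at this

lemma centralIdempotent_mul_vol (hvol : vol p q * vol p q = 1) (ε : ℤˣ) :
    centralIdempotent p q ε * vol p q = ε • centralIdempotent p q ε := by
  rw [centralIdempotent, smul_mul_assoc, add_mul, smul_mul_assoc, hvol, one_mul, smul_comm ε,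
    smul_add ε, smul_smul ε, Int.units_mul_self, one_smul, add_comm (vol p q)]

lemma centralIdempotent_mul_self (hvol : vol p q * vol p q = 1) (ε : ℤˣ) :
    centralIdempotent p q ε * centralIdempotent p q ε = centralIdempotent p q ε := by
  nth_rewrite 2 [centralIdempotent]
  rw [mul_smul_comm, mul_add, mul_one, mul_smul_comm, centralIdempotent_mul_vol hvol, smul_smul,
    Int.units_mul_self, one_smul]
  module

lemma exists_centralIdempotent_mul_eq_smul (hn : Odd (p + q)) (hvol : vol p q * vol p q = 1)
    (ε : ℤˣ) {z : Cl p q} (hz : z ∈ Subalgebra.center ℝ (Cl p q)) :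
    ∃ s : ℝ, centralIdempotent p q ε * z = s • centralIdempotent p q ε := by
  obtain ⟨r, t, rfl⟩ := (mem_center_iff hn).1 hz
  refine ⟨r + t * (ε : ℤ), ?_⟩
  rw [mul_add, mul_smul_comm, mul_smul_comm, mul_one, centralIdempotent_mul_vol hvol,
    Units.smul_def]
  module

lemma Intertwines.exists_mul_eq_centralIdempotent (hn : Odd (p + q))
    (hvol : vol p q * vol p q = 1) (hβ : IsCliffordSystem (signature p q) β)
    (hγ : IsCliffordSystem (signature p q) γ) {T : Cl p q} (hT : Intertwines β γ T) {ε : ℤˣ}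
    (hT0 : centralIdempotent p q ε * T ≠ 0) : ∃ Y, T * Y = centralIdempotent p q ε := by
  have hcenter := centralIdempotent_mem_center hn ε
  obtain ⟨X, hX, hX0⟩ :=
    ((intertwines_self_of_mem_center hcenter).trans hT).exists_mul_ne_zero hn hβ hγ hT0
  obtain ⟨s, hs⟩ := exists_centralIdempotent_mul_eq_smul hn hvol ε hX
  rw [← mul_assoc, ← mul_assoc, centralIdempotent_mul_self hvol] at hs
  rw [hs] at hX0
  refine ⟨centralIdempotent p q ε * (s⁻¹ • X), ?_⟩
  rw [← mul_assoc, Subalgebra.mem_center_iff.1 hcenter, mul_smul_comm, hs,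
    inv_smul_smul₀ (left_ne_zero_of_smul hX0)]

lemma Intertwines.isUnit_of_centralIdempotent_mul_ne_zero (hn : Odd (p + q))
    (hvol : vol p q * vol p q = 1) (hβ : IsCliffordSystem (signature p q) β)
    (hγ : IsCliffordSystem (signature p q) γ) {T : Cl p q} (hT : Intertwines β γ T)
    (hT0 : ∀ ε, centralIdempotent p q ε * T ≠ 0) : IsUnit T := by
  obtain ⟨Y, hY⟩ := hT.exists_mul_eq_centralIdempotent hn hvol hβ hγ (hT0 1)
  obtain ⟨Y', hY'⟩ := hT.exists_mul_eq_centralIdempotent hn hvol hβ hγ (hT0 (-1))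
  exact .of_mul_eq_one (Y + Y') (by rw [mul_add, hY, hY', centralIdempotent_add])

lemma exists_forall_centralIdempotent_mul_evenSum_ne_zero (hn : Odd (p + q))
    (hγ : IsCliffordSystem (signature p q) γ) (β : Fin (p + q) → Cl p q) :
    ∃ A B : Finset (Fin (p + q)), Even A.card ∧ Even B.card ∧
      ∀ ε, centralIdempotent p q ε * evenSum β γ (up γ A + up γ B) ≠ 0 := by
  have hexists (ε : ℤˣ) := exists_mul_evenSum_ne_zero hn hγ β
    (centralIdempotent_mem_center hn ε) (centralIdempotent_ne_zero hn ε)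
  obtain ⟨A, hA, hA0⟩ := hexists 1
  obtain ⟨B, hB, hB0⟩ := hexists (-1)
  have hdouble {x : Cl p q} (hx : x ≠ 0) : x + x ≠ 0 := by
    rwa [← two_mul, isUnit_two.mul_right_eq_zero.ne]
  have hpair {x y : Cl p q} (h₁ : centralIdempotent p q 1 * (x + y) ≠ 0)
      (h₂ : centralIdempotent p q (-1) * (x + y) ≠ 0) (ε : ℤˣ) :
      centralIdempotent p q ε * (x + y) ≠ 0 := by
    rcases Int.units_eq_one_or ε with rfl | rfl <;> assumption
  simp only [map_add]
  by_cases hA' : centralIdempotent p q (-1) * evenSum β γ (up γ A) = 0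
  · by_cases hB' : centralIdempotent p q 1 * evenSum β γ (up γ B) = 0
    · exact ⟨A, B, hA, hB, hpair (by rwa [mul_add, hB', add_zero])
        (by rwa [mul_add, hA', zero_add])⟩
    · exact ⟨B, B, hB, hB, hpair (by rw [mul_add]; exact hdouble hB')
        (by rw [mul_add]; exact hdouble hB0)⟩
  · exact ⟨A, A, hA, hA, hpair (by rw [mul_add]; exact hdouble hA0)
      (by rw [mul_add]; exact hdouble hA')⟩

end UnitIntertwiners

section Bases

lemma IsCliffordSystem.generatesBasis (hn : Odd (p + q))
    (hγ : IsCliffordSystem (signature p q) γ) (htop : top γ = vol p q ∨ top γ = -vol p q) :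
    GeneratesBasis γ := by
  have hpair : Submodule.span ℝ {1, vol p q} ≤ Submodule.span ℝ {1, top γ} := by
    refine Submodule.span_le.2 (Set.pair_subset (Submodule.subset_span (.inl rfl)) ?_)
    exact Submodule.mem_span_pair.2 (by
      rcases htop with h | h
      exacts [⟨0, 1, by simp [h]⟩, ⟨0, -1, by simp [h]⟩])
  have hspan : Submodule.span ℝ (Set.range (up γ)) = ⊤ :=
    span_range_orderedProd_eq_top ℝ hγ (odd_card_fin hn) isUnit_two
      ((span_one_vol_eq hn hγ).ge.trans hpair)
  refine ⟨linearIndependent_of_top_le_span_of_card_eq_finrank hspan.ge ?_, hspan⟩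
  rw [finrank_cl, Fintype.card_finset, Fintype.card_fin]

lemma not_generatesBasis (hn : Odd (p + q)) (htop : top γ = 1 ∨ top γ = -1) :
    ¬ GeneratesBasis γ := by
  rintro ⟨hli, -⟩
  have : Nonempty (Fin (p + q)) := ⟨0, hn.pos⟩
  have hne : Finset.univ ∉ ({∅} : Set (Finset (Fin (p + q)))) := Finset.univ_nonempty.ne_empty
  refine hli.notMem_span_image hne ?_
  rw [Set.image_singleton, Submodule.mem_span_singleton]
  have hempty : up γ ∅ = 1 := orderedProd_empty γ
  rcases htop with h | h
  exacts [⟨1, by rw [hempty, one_smul]; exact h.symm⟩,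
    ⟨-1, by rw [hempty, neg_smul, one_smul]; exact h.symm⟩]

lemma top_generatesBasis_or (hn : Odd (p + q))
    (hγ : IsCliffordSystem (signature p q) γ) :
    ((top γ = vol p q ∨ top γ = -vol p q) ∧ GeneratesBasis γ) ∨
      ((top γ = 1 ∨ top γ = -1) ∧ ¬ GeneratesBasis γ) :=
  (hγ.top_eq hn).imp (fun h ↦ ⟨h, hγ.generatesBasis hn h⟩)
    fun h ↦ ⟨h.2, not_generatesBasis hn h.2⟩

lemma top_generatesBasis (hn : Odd (p + q))
    (hvol : vol p q * vol p q = -1) (hγ : IsCliffordSystem (signature p q) γ) :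
    (top γ = vol p q ∨ top γ = -vol p q) ∧ GeneratesBasis γ := by
  have h := (hγ.top_eq hn).resolve_right fun h ↦ neg_one_ne_one (hvol.symm.trans h.1)
  exact ⟨h, hγ.generatesBasis hn h⟩

end Bases

section PauliTheorem

lemma hEven_eq_zero_iff {U : Cl p q} : HEven β γ U = 0 ↔ evenSum β γ U = 0 :=
  smul_eq_zero_iff_right (by positivity)

lemma isUnit_hEven_iff {U : Cl p q} : IsUnit (HEven β γ U) ↔ IsUnit (evenSum β γ U) :=
  isUnit_smul_iff (Units.mk0 ((1 : ℝ) / 2 ^ (p + q - 1)) (by positivity)) _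

lemma intertwines_hEven (hβ : IsCliffordSystem (signature p q) β)
    (hγ : IsCliffordSystem (signature p q) γ) (U : Cl p q) : Intertwines β γ (HEven β γ U) :=
  (intertwiners ℝ β γ).smul_mem _ (intertwines_evenSum hβ hγ U)

lemma exists_isUnit_hEven_add (hn : Odd (p + q)) (hvol : vol p q * vol p q = 1)
    (hβ : IsCliffordSystem (signature p q) β) (hγ : IsCliffordSystem (signature p q) γ) :
    ∃ A B : Finset (Fin (p + q)), Even A.card ∧ Even B.card ∧
      IsUnit (HEven β γ (up γ A + up γ B)) := by
  obtain ⟨A, B, hA, hB, h⟩ := exists_forall_centralIdempotent_mul_evenSum_ne_zero hn hγ β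
  exact ⟨A, B, hA, hB, isUnit_hEven_iff.2 <|
    (intertwines_evenSum hβ hγ _).isUnit_of_centralIdempotent_mul_ne_zero hn hvol hβ hγ h⟩

lemma exists_hEven_ne_zero (hn : Odd (p + q)) (hγ : IsCliffordSystem (signature p q) γ)
    (β : Fin (p + q) → Cl p q) :
    ∃ A : Finset (Fin (p + q)), Even A.card ∧ HEven β γ (up γ A) ≠ 0 := by
  obtain ⟨A, hA, h⟩ := exists_mul_evenSum_ne_zero hn hγ β (Subalgebra.one_mem _) one_ne_zero
  exact ⟨A, hA, hEven_eq_zero_iff.not.2 (by rwa [one_mul] at h)⟩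

lemma exists_units_intertwines (hn : Odd (p + q)) (hβ : IsCliffordSystem (signature p q) β)
    (hγ : IsCliffordSystem (signature p q) γ) :
    ∃ T : (Cl p q)ˣ, Intertwines β γ (T : Cl p q) := by
  suffices ∃ U, IsUnit (HEven β γ U) by
    obtain ⟨U, T, hT⟩ := this
    exact ⟨T, hT ▸ intertwines_hEven hβ hγ U⟩
  obtain ⟨s, hvol, rfl | rfl⟩ := exists_vol_mul_vol_eq_smul_one hn
  · obtain ⟨A, B, -, -, h⟩ := exists_isUnit_hEven_add hn (by rwa [one_smul] at hvol) hβ hγ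
    exact ⟨_, h⟩
  · obtain ⟨A, -, h⟩ := exists_hEven_ne_zero hn hγ β
    exact ⟨_, (intertwines_hEven hβ hγ _).isUnit hn (by rwa [neg_smul, one_smul] at hvol) hβ hγ h⟩

lemma exists_connects_iff (hn : Odd (p + q)) (hβ : IsCliffordSystem (signature p q) β)
    (hγ : IsCliffordSystem (signature p q) γ) {c : Cl p q}
    (hc : c ∈ Subalgebra.center ℝ (Cl p q)) :
    (∃ T, Connects c β γ T) ↔ top β = c * top γ := by
  simp only [connects_iff hn hβ hγ hc, exists_and_left, exists_units_intertwines hn hβ hγ, and_true]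

lemma connects_of_eq_hEven (hn : Odd (p + q)) (hβ : IsCliffordSystem (signature p q) β)
    (hγ : IsCliffordSystem (signature p q) γ) {c : Cl p q}
    (hc : c ∈ Subalgebra.center ℝ (Cl p q)) (htop : top β = c * top γ) {T : (Cl p q)ˣ}
    {U : Cl p q} (hT : (T : Cl p q) = HEven β γ U) : Connects c β γ T :=
  (connects_iff hn hβ hγ hc).2 ⟨htop, hT ▸ intertwines_hEven hβ hγ U⟩

end PauliTheorem

end RealCliffordAlgebra

end PauliOdd

end

open PauliOdd in
theorem theorem17 (p q : ℕ) (hn : Odd (p + q)) (γ β : Fin (p + q) → PauliOdd.Cl p q)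
    (hγ : PauliOdd.CliffordRelations γ) (hβ : PauliOdd.CliffordRelations β) :
    -- signature `p - q ≡ 1 mod 4`: the top products, and exactly one of the cases 1-4
    ((p : ℤ) - q ≡ 1 [ZMOD 4] →
      (∀ δ ∈ ({γ, β} : Set (Fin (p + q) → PauliOdd.Cl p q)),
        ((PauliOdd.top δ = PauliOdd.vol p q ∨ PauliOdd.top δ = -PauliOdd.vol p q) ∧
            PauliOdd.GeneratesBasis δ) ∨
          ((PauliOdd.top δ = 1 ∨ PauliOdd.top δ = -1) ∧ ¬ PauliOdd.GeneratesBasis δ)) ∧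
      ∃! c : PauliOdd.Cl p q,
        c ∈ ({1, -1, PauliOdd.vol p q, -PauliOdd.vol p q} : Set (PauliOdd.Cl p q)) ∧
          PauliOdd.top β = c * PauliOdd.top γ) ∧
    -- signature `p - q ≡ 3 mod 4`: the top products, and exactly one of the cases 1-2, never 3-4
    ((p : ℤ) - q ≡ 3 [ZMOD 4] →
      (∀ δ ∈ ({γ, β} : Set (Fin (p + q) → PauliOdd.Cl p q)),
        (PauliOdd.top δ = PauliOdd.vol p q ∨ PauliOdd.top δ = -PauliOdd.vol p q) ∧
            PauliOdd.GeneratesBasis δ) ∧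
      (∃! c : PauliOdd.Cl p q, c ∈ ({1, -1} : Set (PauliOdd.Cl p q)) ∧
          PauliOdd.top β = c * PauliOdd.top γ) ∧
      ∀ c ∈ ({PauliOdd.vol p q, -PauliOdd.vol p q} : Set (PauliOdd.Cl p q)),
        PauliOdd.top β ≠ c * PauliOdd.top γ ∧ ¬ ∃ T, PauliOdd.Connects c β γ T) ∧
    -- the four cases: existence criterion, and uniqueness up to invertible central factors
    (∀ c ∈ ({1, -1, PauliOdd.vol p q, -PauliOdd.vol p q} : Set (PauliOdd.Cl p q)),
      ((∃ T, PauliOdd.Connects c β γ T) ↔ PauliOdd.top β = c * PauliOdd.top γ) ∧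
      ∀ T, PauliOdd.Connects c β γ T → ∀ T', PauliOdd.Connects c β γ T' ↔
        ∃ Z : (PauliOdd.Cl p q)ˣ,
          (Z : PauliOdd.Cl p q) ∈ Subalgebra.center ℝ (PauliOdd.Cl p q) ∧ T' = Z * T) ∧
    -- the unified form `γ^a = (β^{1…n} γ_{1…n}) T⁻¹ β^a T` of the four cases
    (∀ T, PauliOdd.Connects (PauliOdd.top β * PauliOdd.down γ Finset.univ) β γ T ↔
      ∃ c ∈ ({1, -1, PauliOdd.vol p q, -PauliOdd.vol p q} : Set (PauliOdd.Cl p q)),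
        PauliOdd.Connects c β γ T) ∧
    -- explicit `T` for `p - q ≡ 1 mod 4`
    ((p : ℤ) - q ≡ 1 [ZMOD 4] →
      ∃ A B : Finset (Fin (p + q)), Even A.card ∧ Even B.card ∧
        ∃ T : (PauliOdd.Cl p q)ˣ,
          (T : PauliOdd.Cl p q) = PauliOdd.HEven β γ (PauliOdd.up γ A + PauliOdd.up γ B) ∧
          ∀ c ∈ ({1, -1, PauliOdd.vol p q, -PauliOdd.vol p q} : Set (PauliOdd.Cl p q)),
            PauliOdd.top β = c * PauliOdd.top γ → PauliOdd.Connects c β γ T) ∧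
    -- explicit `T` for `p - q ≡ 3 mod 4`
    ((p : ℤ) - q ≡ 3 [ZMOD 4] →
      (∃ A : Finset (Fin (p + q)), Even A.card ∧
        PauliOdd.HEven β γ (PauliOdd.up γ A) ≠ 0) ∧
      ∀ A : Finset (Fin (p + q)), Even A.card → PauliOdd.HEven β γ (PauliOdd.up γ A) ≠ 0 →
        ∃ T : (PauliOdd.Cl p q)ˣ,
          (T : PauliOdd.Cl p q) = PauliOdd.HEven β γ (PauliOdd.up γ A) ∧
          ∀ c ∈ ({1, -1} : Set (PauliOdd.Cl p q)),
            PauliOdd.top β = c * PauliOdd.top γ → PauliOdd.Connects c β γ T) := by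
  have hβ' := hβ.isCliffordSystem
  have hγ' := hγ.isCliffordSystem
  have hcenter {c} (hc : c ∈ factors p q) := factors_subset_center hn hc
  refine ⟨fun _ ↦ ⟨?_, existsUnique_factor hn hβ' hγ'⟩, fun h ↦ ?_,
    fun c hc ↦ ⟨exists_connects_iff hn hβ' hγ' (hcenter hc),
      fun T hT T' ↦ hT.iff_exists_central_mul hn hβ' hγ' (hcenter hc)⟩,
    fun T ↦ connects_top_mul_down_iff hn hβ' hγ', fun h ↦ ?_, fun h ↦ ?_⟩
  · rintro δ (rfl | rfl)
    exacts [top_generatesBasis_or hn hγ', top_generatesBasis_or hn hβ']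
  · have hvol := vol_mul_vol_of_modEq_three h
    refine ⟨?_, existsUnique_sign_factor hn hvol hβ' hγ', fun c hc ↦ ?_⟩
    · rintro δ (rfl | rfl)
      exacts [top_generatesBasis hn hvol hγ', top_generatesBasis hn hvol hβ']
    · rw [exists_connects_iff hn hβ' hγ' (hcenter (.inr (.inr hc))), and_self]
      exact ne_vol_mul_of_vol_mul_vol_eq_neg_one hn hvol hβ' hγ' hc
  · obtain ⟨A, B, hA, hB, T, hT⟩ := exists_isUnit_hEven_add hn
      (vol_mul_vol_of_modEq_one h) hβ' hγ'
    exact ⟨A, B, hA, hB, T, hT, fun c hc htop ↦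
      connects_of_eq_hEven hn hβ' hγ' (hcenter hc) htop hT⟩
  · refine ⟨exists_hEven_ne_zero hn hγ' β, fun A _ hA0 ↦ ?_⟩
    obtain ⟨T, hT⟩ := (intertwines_hEven hβ' hγ' _).isUnit hn
      (vol_mul_vol_of_modEq_three h) hβ' hγ' hA0
    exact ⟨T, hT, fun c hc htop ↦ connects_of_eq_hEven hn hβ' hγ'
      (hcenter (hc.imp_right .inl)) htop hT⟩
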